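/- Let $\mathbb{S}^3$ be the 6-dimensional space of complex symmetric $3\times 3$ matrices, identified with quadratic forms in $x,y,z$, on which $P\in \mathrm{GL}_3(\mathbb{C})$ acts by congruence $M\mapsto P^TMP$. A net of conics (a 3-dimensional linear subspace $\mathcal{L}\subset\mathbb{S}^3$) is of type $B$, respectively $C$, if it is congruent to the net spanned by $$S_1=y^2+2xz,\qquad S_2=2yz,\qquad S_3=\begin{cases}-x^2-2y^2-9z^2+2xz & (\text{type } B),\\ -x^2 & (\text{type } C).\end{cases}$$ Put $g=1$ for type $B$ and $g=0$ for type $C$. Let $v:\mathbb{P}^2\to\mathbb{P}^5=\mathbb{P}\mathbb{S}^3$, $a\mapsto aa^T$, be the Veronese embedding. The reciprocal surface $\mathbb{P}\mathcal{L}^{-1}\subset\mathbb{P}^5$ is the Zariski closure of $\{[A^{-1}] : A\in\mathcal{L},\ \det A\neq 0\}$. A projection of a subset $X\subset\mathbb{P}^5$ from a point $p$ is the Zariski closure of the image of $X\setminus\{p\}$ under the map $\mathbb{P}^5\setminus\{p\}\to\mathbb{P}^5$ induced by a linear map $\pi:\mathbb{S}^3\to\mathbb{S}^3$ whose kernel is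 the line $p$. **Proposition 3.5.** Let $\mathcal{L}$ be a net of type $B$ or $C$. Then $\mathbb{P}\mathcal{L}^{-1}$ has dimension $2$ and degree $3$, and it is a projection of the Veronese surface $v(\mathbb{P}^2)$ from a point on the Veronese surface. More precisely, for every $P\in \mathrm{GL}_3(\mathbb{C})$ such that $\mathcal{L}$ is spanned by the matrices $P^TS_iP$ $(i=1,2,3)$, there is a linear map $\pi:\mathbb{S}^3\to\mathbb{S}^3$ with $$\pi\bigl(aa^T\bigr)=\operatorname{adj}\bigl(\alpha\,P^TS_1P+\beta\,P^TS_2P+\gamma\,P^TS_3P\bigr)\qquad\text{for all } a=(\alpha,\beta,\gamma)^T\in\mathbb{C}^3,$$ the kernel of $\pi$ is the line $v(2g:0:1)$, and $\mathbb{P}\mathcal{L}^{-1}$ is the projection of the Veronese surface from the point $v(2g:0:1)$ induced by $\pi$. -/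

import Mathlib

namespace NetsOfConics

noncomputable section

open Matrix Polynomial
open scoped LinearAlgebra.Projectivization

/-- The 6-dimensional space of complex symmetric `3 × 3` matrices. -/
def SymMat : Submodule ℂ (Matrix (Fin 3) (Fin 3) ℂ) where
  carrier := {M | M.IsSymm}
  add_mem' hM hN := hM.add hN
  zero_mem' := Matrix.isSymm_zero
  smul_mem' c _ hM := hM.smul c

/-- The projective space `ℙ⁵` of symmetric `3 × 3` matrices. -/
abbrev P5 : Type := ℙ ℂ SymMat

/-! ### Projective geometry in `ℙ⁵` -/

/-- The six homogeneous coordinates `(u₁₁, u₂₂, u₃₃, u₁₂, u₁₃, u₂₃)` of a symmetric matrix. -/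
def coords (M : SymMat) : Fin 6 → ℂ :=
  ![M.1 0 0, M.1 1 1, M.1 2 2, M.1 0 1, M.1 0 2, M.1 1 2]

/-- The (homogeneous) vanishing ideal of a subset of `ℙ⁵`: the polynomials that vanish at all
representatives of all of its points. -/
def vanishingIdeal (Z : Set P5) : Ideal (MvPolynomial (Fin 6) ℂ) where
  carrier := {f | ∀ x ∈ Z, ∀ M ∈ x.submodule, MvPolynomial.eval (coords M) f = 0}
  add_mem' hf hg x hx M hM := by rw [map_add, hf x hx M hM, hg x hx M hM, add_zero]
  zero_mem' _ _ _ _ := map_zero _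
  smul_mem' f g hg x hx M hM := by rw [smul_eq_mul, map_mul, hg x hx M hM, mul_zero]

/-- The Zariski closure of a subset of `ℙ⁵`: the common zeros of its vanishing ideal. -/
def zariskiClosure (Z : Set P5) : Set P5 :=
  {x | ∀ f ∈ vanishingIdeal Z, ∀ M ∈ x.submodule, MvPolynomial.eval (coords M) f = 0}

/-- The Hilbert function of the homogeneous coordinate ring of a subset of `ℙ⁵`: in degree `n`, the
dimension of the forms of degree `n` modulo those in the vanishing ideal. -/
def hilbertFunction (Z : Set P5) (n : ℕ) : ℕ :=
  Module.finrank ℂ (MvPolynomial.homogeneousSubmodule (Fin 6) ℂ n ⧸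
    ((vanishingIdeal Z).restrictScalars ℂ).comap
      (MvPolynomial.homogeneousSubmodule (Fin 6) ℂ n).subtype)

/-- `q` is the Hilbert polynomial of `Z`. -/
def IsHilbertPolynomial (Z : Set P5) (q : ℚ[X]) : Prop :=
  ∀ᶠ n : ℕ in Filter.atTop, (hilbertFunction Z n : ℚ) = q.eval (n : ℚ)

/-- `Z` has dimension `r` and degree `d`: its Hilbert polynomial has degree `r` and leading
coefficient `d / r!`. -/
def HasDimAndDegree (Z : Set P5) (r d : ℕ) : Prop :=
  ∃ q : ℚ[X], IsHilbertPolynomial Z q ∧ q.degree = (r : WithBot ℕ) ∧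
    q.leadingCoeff * (r.factorial : ℚ) = (d : ℚ)

/-- The image of `X ⊆ ℙ⁵` under the rational map of projective spaces induced by a linear map:
the Zariski closure of the image of the points of `X` outside the projectivized kernel. -/
def imageUnder (π : SymMat →ₗ[ℂ] SymMat) (X : Set P5) : Set P5 :=
  zariskiClosure {y | ∃ x ∈ X, ∃ M ∈ x.submodule, ∃ h : π M ≠ 0, y = Projectivization.mk ℂ (π M) h}

/-- The linear map `π` exhibits `Y` as the projection of `X` from the point `p`. -/
def IsProjectionVia (π : SymMat →ₗ[ℂ] SymMat) (X : Set P5) (p : P5) (Y : Set P5) : Prop :=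
  LinearMap.ker π = p.submodule ∧ Y = imageUnder π X

/-! ### The Veronese surface -/

/-- The symmetric matrix `(aᵢ aⱼ)` of a vector `a`. -/
def veroneseVec (a : Fin 3 → ℂ) : SymMat :=
  ⟨vecMulVec a a, by
    change (vecMulVec a a)ᵀ = vecMulVec a a
    rw [transpose_vecMulVec]⟩

lemma veroneseVec_ne_zero {a : Fin 3 → ℂ} (ha : a ≠ 0) : veroneseVec a ≠ 0 := by
  obtain ⟨i, hi⟩ := Function.ne_iff.mp ha
  intro h
  have h1 : (veroneseVec a).1 i i = 0 := by rw [h]; rfl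
  exact mul_ne_zero hi hi h1

/-- The Veronese embedding `v : ℙ² → ℙ⁵`, `(α : β : γ) ↦ [(α, β, γ)ᵀ (α, β, γ)]`. -/
def veronese : ℙ ℂ (Fin 3 → ℂ) → P5 :=
  Projectivization.lift
    (fun a => Projectivization.mk ℂ (veroneseVec a.1) (veroneseVec_ne_zero a.2)) (by
      rintro ⟨a, ha⟩ ⟨b, hb⟩ t h
      simp only at h
      rw [Projectivization.mk_eq_mk_iff']
      refine ⟨t * t, ?_⟩
      apply Subtype.ext
      ext i j
      simp only [veroneseVec, h, SetLike.val_smul, Matrix.smul_apply, vecMulVec_apply,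
        Pi.smul_apply, smul_eq_mul]
      ring)

/-- The Veronese surface in `ℙ⁵`. -/
def veroneseSurface : Set P5 := Set.range veronese

/-! ### Nets of conics and their reciprocal surfaces -/

/-- The inverse of a symmetric matrix. -/
def symInv (A : SymMat) : SymMat :=
  ⟨A.1⁻¹, by
    change (A.1⁻¹)ᵀ = A.1⁻¹
    rw [transpose_nonsing_inv, show A.1ᵀ = A.1 from A.2]⟩

/-- The reciprocal surface of a net: the Zariski closure of the set of the classes of the inverses
of its invertible matrices. -/
def reciprocalSurface (L : Submodule ℂ SymMat) : Set P5 :=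
  zariskiClosure {x | ∃ A ∈ L, A.1.det ≠ 0 ∧
    ∃ h : symInv A ≠ 0, x = Projectivization.mk ℂ (symInv A) h}

/-- The congruence action `M ↦ Pᵀ M P`. -/
def congruence (P : GL (Fin 3) ℂ) : SymMat →ₗ[ℂ] SymMat where
  toFun M := ⟨(P.1)ᵀ * M.1 * P.1, by
    change ((P.1)ᵀ * M.1 * P.1)ᵀ = (P.1)ᵀ * M.1 * P.1
    rw [transpose_mul, transpose_mul, transpose_transpose, show M.1ᵀ = M.1 from M.2,
      Matrix.mul_assoc]⟩
  map_add' M N := by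
    apply Subtype.ext
    simp [Matrix.mul_add, Matrix.add_mul]
  map_smul' c M := by
    apply Subtype.ext
    simp

/-- The two types of nets considered here. -/
inductive NetType
  | B
  | C

/-- The constant `g` of the type: `1` for `B` and `0` for `C`. -/
def NetType.g : NetType → ℂ
  | .B => 1
  | .C => 0

/-- The matrices of the generators `y² + 2xz`, `2yz` and
`-x² - 2y² - 9z² + 2xz` (type `B`), respectively `-x²` (type `C`). -/
def NetType.genMatrix : NetType → Fin 3 → Matrix (Fin 3) (Fin 3) ℂ
  | .B => ![!![0, 0, 1; 0, 1, 0; 1, 0, 0],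
            !![0, 0, 0; 0, 0, 1; 0, 1, 0],
            !![-1, 0, 1; 0, -2, 0; 1, 0, -9]]
  | .C => ![!![0, 0, 1; 0, 1, 0; 1, 0, 0],
            !![0, 0, 0; 0, 0, 1; 0, 1, 0],
            !![-1, 0, 0; 0, 0, 0; 0, 0, 0]]

lemma NetType.genMatrix_mem (τ : NetType) (i : Fin 3) : τ.genMatrix i ∈ SymMat := by
  change (τ.genMatrix i)ᵀ = τ.genMatrix i
  cases τ <;> fin_cases i <;> ext j k <;> fin_cases j <;> fin_cases k <;> rfl

/-- The three generators of the standard net of the given type. -/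
def NetType.gen (τ : NetType) (i : Fin 3) : SymMat := ⟨τ.genMatrix i, τ.genMatrix_mem i⟩

/-- The standard net of the given type. -/
def NetType.standardNet (τ : NetType) : Submodule ℂ SymMat :=
  Submodule.span ℂ (Set.range τ.gen)

/-- `L` is a net of type `τ`: it lies in the orbit of the standard net under congruence. -/
def IsOfType (τ : NetType) (L : Submodule ℂ SymMat) : Prop :=
  ∃ P : GL (Fin 3) ℂ, L = τ.standardNet.map (congruence P)

/-- The point `(2g : 0 : 1)` of `ℙ²`. -/
def NetType.basePoint (τ : NetType) : ℙ ℂ (Fin 3 → ℂ) :=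
  Projectivization.mk ℂ ![2 * τ.g, 0, 1] (fun h => one_ne_zero (congrFun h 2))

end

end NetsOfConics

namespace NetsOfConics

noncomputable section

open Matrix MvPolynomial
open scoped LinearAlgebra.Projectivization

/-! ### Zariski closures and Hilbert functions -/

/-! The entries of the adjugate of a general member of the net are conics in `a`, and they span
exactly the 5-dimensional space of conics through `(2g : 0 : 1)`. After moving that point to `(0 : 0
: 1)` by `shift`, the adjugate is `netAdj (conics b)` with `netAdj` linear and injective
(`adjugate_sum`, `netAdj_injective`). The same five conics are linear in `aaᵀ`, with kernel the line
over the base point (`ker_conicLinear`), which gives `π`. Inverses and projected Veronese points are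
thus, up to scalars, values of the same map on sets of `b` containing the complement of a curve, so
both vanishing ideals are the kernel of one substitution (`mem_vanishingIdeal_iff`) and the closures
agree. In degree `n` the image of that substitution has as basis the monomials of degree `2n` with
exponent of `X 2` at most `n`; there are `(3n² + 5n + 2) / 2` of them, whence dimension 2 and degree
3. -/

lemma vanishingIdeal_zariskiClosure (Z : Set P5) :
    vanishingIdeal (zariskiClosure Z) = vanishingIdeal Z := by
  ext f
  exact ⟨fun hf x hx M hM => hf x (fun g hg N hN => hg x hx N hN) M hM,
    fun hf x hx M hM => hx f hf M hM⟩

lemma zariskiClosure_congr {Z W : Set P5} (h : vanishingIdeal Z = vanishingIdeal W) :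
    zariskiClosure Z = zariskiClosure W := by
  simp only [zariskiClosure, h]

lemma hilbertFunction_eq_finrank_map {σ : Type*} {Z : Set P5}
    (φ : MvPolynomial (Fin 6) ℂ →ₐ[ℂ] MvPolynomial σ ℂ)
    (h : ∀ f, f ∈ vanishingIdeal Z ↔ φ f = 0) (n : ℕ) :
    hilbertFunction Z n =
      Module.finrank ℂ ((homogeneousSubmodule (Fin 6) ℂ n).map φ.toLinearMap) := by
  have hker : ((vanishingIdeal Z).restrictScalars ℂ).comap
      (homogeneousSubmodule (Fin 6) ℂ n).subtype =
      LinearMap.ker (φ.toLinearMap.domRestrict (homogeneousSubmodule (Fin 6) ℂ n)) := by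
    ext f
    simp [h]
  rw [hilbertFunction, hker, (LinearMap.quotKerEquivRange _).finrank_eq,
    LinearMap.range_domRestrict]

/-- Substitution of the linear forms that are the coordinates of a linear map. -/
def linearSubst {m k : ℕ} (l : (Fin k → ℂ) →ₗ[ℂ] (Fin m → ℂ)) :
    MvPolynomial (Fin m) ℂ →ₐ[ℂ] MvPolynomial (Fin k) ℂ :=
  aeval fun i => ∑ j, C (l (Pi.single j 1) i) * X j

lemma eval_linearSubst {m k : ℕ} (l : (Fin k → ℂ) →ₗ[ℂ] (Fin m → ℂ)) (u : Fin k → ℂ)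
    (f : MvPolynomial (Fin m) ℂ) : eval u (linearSubst l f) = eval (l u) f := by
  have hu : l u = fun i => ∑ j, l (Pi.single j 1) i * u j := by
    conv_lhs => rw [pi_eq_sum_univ' u, map_sum]
    ext i
    simp [mul_comm]
  rw [hu, linearSubst, ← MvPolynomial.coe_aeval_eq_eval, ← MvPolynomial.coe_aeval_eq_eval]
  change ((aeval u).comp (aeval _)) f = aeval _ f
  rw [comp_aeval]
  simp

lemma linearSubst_mem {m k n : ℕ} (l : (Fin k → ℂ) →ₗ[ℂ] (Fin m → ℂ))
    {f : MvPolynomial (Fin m) ℂ} (hf : f ∈ homogeneousSubmodule (Fin m) ℂ n) :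
    linearSubst l f ∈ homogeneousSubmodule (Fin k) ℂ n := by
  rw [mem_homogeneousSubmodule] at hf ⊢
  have := hf.aeval (S := ℂ) (φ := f) (fun i => ∑ j, C (l (Pi.single j 1) i) * X j) (n := 1)
    (fun i => IsHomogeneous.sum _ _ _ fun j _ => by
      simpa using (isHomogeneous_C (Fin k) (l (Pi.single j 1) i)).mul (isHomogeneous_X ℂ j))
  simpa [linearSubst] using this

/-- A left inverse `s` of `l` gives preimages: substituting `s` and then `l` is evaluation at `s (l
u) = u`. -/
lemma map_linearSubst_homogeneousSubmodule {m k : ℕ} (l : (Fin k → ℂ) →ₗ[ℂ] (Fin m → ℂ))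
    (hl : Function.Injective l) (n : ℕ) :
    (homogeneousSubmodule (Fin m) ℂ n).map (linearSubst l).toLinearMap =
      homogeneousSubmodule (Fin k) ℂ n := by
  refine le_antisymm ?_ fun f hf => ?_
  · rintro _ ⟨f, hf, rfl⟩
    exact linearSubst_mem l hf
  · obtain ⟨s, hs⟩ := l.exists_leftInverse_of_injective (LinearMap.ker_eq_bot.mpr hl)
    refine ⟨linearSubst s f, linearSubst_mem s hf, ?_⟩
    refine MvPolynomial.funext fun u => ?_
    have hsu : s (l u) = u := LinearMap.congr_fun hs u
    simp [eval_linearSubst, hsu]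

/-! ### The conics through a point -/

/-- The conics through `(0 : 0 : 1)`, evaluated at `b`. -/
def conics (b : Fin 3 → ℂ) : Fin 5 → ℂ :=
  ![b 0 ^ 2, b 0 * b 1, b 1 ^ 2, b 0 * b 2, b 1 * b 2]

/-- Substitution of the conics through `(0 : 0 : 1)`. -/
def conicSubst : MvPolynomial (Fin 5) ℂ →ₐ[ℂ] MvPolynomial (Fin 3) ℂ :=
  aeval ![X 0 ^ 2, X 0 * X 1, X 1 ^ 2, X 0 * X 2, X 1 * X 2]

lemma eval_conicSubst (b : Fin 3 → ℂ) (f : MvPolynomial (Fin 5) ℂ) :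
    eval b (conicSubst f) = eval (conics b) f := by
  rw [conicSubst, ← MvPolynomial.coe_aeval_eq_eval, ← MvPolynomial.coe_aeval_eq_eval]
  change ((aeval b).comp (aeval _)) f = aeval _ f
  rw [comp_aeval]
  congr 2
  ext i
  fin_cases i <;> simp [conics]

lemma conics_smul (d : ℂ) (b : Fin 3 → ℂ) : conics (d • b) = d ^ 2 • conics b := by
  ext i
  fin_cases i <;> simp [conics] <;> ring

/-- The exponents of the monomials of degree `2 * n` in the `n`-th power of the ideal of
`(0 : 0 : 1)`. -/
def conicExponents (n : ℕ) : Set (Fin 3 →₀ ℕ) :=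
  {e | e 0 + e 1 + e 2 = 2 * n ∧ e 2 ≤ n}

/-- The exponent of the monomial obtained by substitution of the conics. -/
def conicExponent (d : Fin 5 →₀ ℕ) : Fin 3 →₀ ℕ :=
  Finsupp.equivFunOnFinite.symm ![2 * d 0 + d 1 + d 3, d 1 + 2 * d 2 + d 4, d 3 + d 4]

lemma conicSubst_monomial (d : Fin 5 →₀ ℕ) :
    conicSubst (monomial d 1) = monomial (conicExponent d) 1 := by
  rw [conicSubst, aeval_monomial, monomial_eq, Finsupp.prod_fintype _ _ (by simp),
    Finsupp.prod_fintype _ _ (by simp)]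
  simp [Fin.prod_univ_succ, conicExponent]
  ring

lemma image_conicExponent (n : ℕ) :
    conicExponent '' {d | d.degree = n} = conicExponents n := by
  ext e
  constructor
  · rintro ⟨d, hd, rfl⟩
    simp only [Set.mem_ofPred_eq, Finsupp.degree_eq_sum, Fin.sum_univ_five] at hd
    simp [conicExponents, conicExponent]
    omega
  · rintro ⟨h1, h2⟩
    -- Use `xz` as often as possible, then `yz` for the remaining `z`; the bound `e 2 ≤ n` leaves
    -- enough `y`. An odd remaining power of `x` takes one `xy`, and the rest are squares.
    refine ⟨Finsupp.equivFunOnFinite.symm ![(e 0 - min (e 0) (e 2)) / 2,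
      (e 0 - min (e 0) (e 2)) % 2, (e 1 - (e 2 - min (e 0) (e 2))) / 2, min (e 0) (e 2),
      e 2 - min (e 0) (e 2)], ?_, ?_⟩
    · simp [Finsupp.degree_eq_sum, Fin.sum_univ_five]
      omega
    · ext i
      fin_cases i <;> simp [conicExponent] <;> omega

/-- Monomials go to monomials with coefficient 1, so only the set of exponents matters. -/
lemma map_conicSubst_homogeneousSubmodule (n : ℕ) :
    (homogeneousSubmodule (Fin 5) ℂ n).map conicSubst.toLinearMap =
      restrictSupport ℂ (conicExponents n) := by
  rw [homogeneousSubmodule_eq_finsupp_supported, restrictSupport, ← image_conicExponent]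
  erw [AddMonoidAlgebra.supported_eq_span_single, AddMonoidAlgebra.supported_eq_span_single]
  rw [Submodule.map_span, Set.image_image, Set.image_image]
  congr 1
  refine Set.image_congr fun d _ => conicSubst_monomial d

lemma card_conicExponents (n : ℕ) :
    2 * Nat.card (conicExponents n) = (n + 1) * (3 * n + 2) := by
  -- Fibre over `k = e 2`: then `e 0` ranges over `0, …, 2n - k` and determines `e 1`.
  let φ : conicExponents n ≃ Σ k : Fin (n + 1), Fin (2 * n - k + 1) :=
    { toFun := fun e => ⟨⟨e.1 2, by have := e.2.2; omega⟩, ⟨e.1 0, by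
        have := e.2.1; simp only; omega⟩⟩
      invFun := fun p => ⟨Finsupp.equivFunOnFinite.symm ![p.2, 2 * n - p.1 - p.2, p.1], by
        have h1 := p.1.2
        have h2 := p.2.2
        simp [conicExponents]
        omega⟩
      left_inv := fun e => by
        have := e.2.1
        ext i
        fin_cases i <;> simp
        omega
      right_inv := fun p => by
        rcases p with ⟨⟨k, hk⟩, ⟨i, hi⟩⟩
        simp }
  have key : ∀ m, m ≤ 2 * n → 2 * ∑ k ∈ Finset.range (m + 1), (2 * n - k + 1) + m * (m + 1) =
      2 * ((m + 1) * (2 * n + 1)) := by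
    intro m hm
    induction m with
    | zero => simp
    | succ m ih =>
      rw [Finset.sum_range_succ]
      obtain ⟨t, ht⟩ := Nat.exists_eq_add_of_le hm
      have := ih (by omega)
      have h2 : 2 * n - (m + 1) = t := by omega
      rw [h2]
      rw [ht] at this ⊢
      nlinarith
  have := key n (by omega)
  rw [Nat.card_congr φ, Nat.card_eq_fintype_card, Fintype.card_sigma]
  simp only [Fintype.card_fin]
  rw [Fin.sum_univ_eq_sum_range (fun k => 2 * n - k + 1) (n + 1)]
  nlinarith

/-! ### Sets parametrized by the conics through a point -/

/-- The coordinates of a symmetric matrix, as a linear map. -/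
def coordsLinear : SymMat →ₗ[ℂ] (Fin 6 → ℂ) where
  toFun := coords
  map_add' M N := by
    ext i
    fin_cases i <;> simp [coords]
  map_smul' c M := by
    ext i
    fin_cases i <;> simp [coords]

lemma symMat_ext {M N : SymMat} (h00 : M.1 0 0 = N.1 0 0) (h11 : M.1 1 1 = N.1 1 1)
    (h22 : M.1 2 2 = N.1 2 2) (h01 : M.1 0 1 = N.1 0 1) (h02 : M.1 0 2 = N.1 0 2)
    (h12 : M.1 1 2 = N.1 1 2) : M = N := by
  have hM : ∀ i j, M.1 i j = M.1 j i := fun i j => Matrix.IsSymm.apply M.2 j i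
  have hN : ∀ i j, N.1 i j = N.1 j i := fun i j => Matrix.IsSymm.apply N.2 j i
  have h10 : M.1 1 0 = N.1 1 0 := by rw [hM, hN, h01]
  have h20 : M.1 2 0 = N.1 2 0 := by rw [hM, hN, h02]
  have h21 : M.1 2 1 = N.1 2 1 := by rw [hM, hN, h12]
  apply Subtype.ext
  ext i j
  fin_cases i <;> fin_cases j <;> assumption

lemma coordsLinear_injective : Function.Injective coordsLinear := by
  intro M N h
  have h' : ∀ i, coords M i = coords N i := fun i => congrFun h i
  exact symMat_ext (h' 0) (h' 1) (h' 2) (h' 3) (h' 4) (h' 5)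

/-- `Z` consists of classes of points `r (conics b)`, for `b` including the complement of a
curve. -/
structure IsParametrizedBy (r : (Fin 5 → ℂ) →ₗ[ℂ] SymMat) (Z : Set P5) : Prop where
  exists_eq : ∀ x ∈ Z, ∃ b, ∃ h : r (conics b) ≠ 0, x = Projectivization.mk ℂ (r (conics b)) h
  exists_mem : ∃ D : MvPolynomial (Fin 3) ℂ, D ≠ 0 ∧
    ∀ b, eval b D ≠ 0 → ∃ x ∈ Z, r (conics b) ∈ x.submodule

/-- Conics are homogeneous of degree 2, so a square root of `c` can be absorbed into `b`. This
handles all representatives of a projective point. -/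
lemma smul_conics (r : (Fin 5 → ℂ) →ₗ[ℂ] SymMat) (c : ℂ) (b : Fin 3 → ℂ) :
    ∃ b', c • r (conics b) = r (conics b') := by
  obtain ⟨d, hd⟩ := IsAlgClosed.exists_pow_nat_eq c (n := 2) (by norm_num)
  exact ⟨d • b, by rw [conics_smul, hd, map_smul]⟩

lemma IsParametrizedBy.mem_vanishingIdeal_iff {r : (Fin 5 → ℂ) →ₗ[ℂ] SymMat} {Z : Set P5}
    (hZ : IsParametrizedBy r Z) (f : MvPolynomial (Fin 6) ℂ) :
    f ∈ vanishingIdeal Z ↔ (conicSubst.comp (linearSubst (coordsLinear ∘ₗ r))) f = 0 := by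
  have heval : ∀ b, eval b ((conicSubst.comp (linearSubst (coordsLinear ∘ₗ r))) f) =
      eval (coords (r (conics b))) f := fun b => by
    rw [AlgHom.comp_apply, eval_conicSubst, eval_linearSubst]
    rfl
  constructor
  · intro hf
    obtain ⟨D, hD0, hD⟩ := hZ.exists_mem
    -- Density of the complement of `D = 0`: the product with `D` vanishes everywhere, and the
    -- polynomial ring is a domain.
    refine (mul_eq_zero.mp (?_ : D * _ = 0)).resolve_left hD0
    refine MvPolynomial.funext fun b => ?_
    rw [map_mul, map_zero, heval]
    by_cases hb : eval b D = 0
    · rw [hb, zero_mul]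
    · obtain ⟨x, hx, hbx⟩ := hD b hb
      rw [hf x hx _ hbx, mul_zero]
  · intro hf x hx M hM
    obtain ⟨b, hb, rfl⟩ := hZ.exists_eq x hx
    rw [Projectivization.submodule_mk, Submodule.mem_span_singleton] at hM
    obtain ⟨c, rfl⟩ := hM
    obtain ⟨b', hb'⟩ := smul_conics r c b
    rw [hb', ← heval, hf, map_zero]

lemma IsParametrizedBy.zariskiClosure_eq {r : (Fin 5 → ℂ) →ₗ[ℂ] SymMat} {Z W : Set P5}
    (hZ : IsParametrizedBy r Z) (hW : IsParametrizedBy r W) :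
    zariskiClosure Z = zariskiClosure W :=
  zariskiClosure_congr <| Ideal.ext fun f => by
    rw [hZ.mem_vanishingIdeal_iff, hW.mem_vanishingIdeal_iff]

lemma IsParametrizedBy.hilbertFunction_zariskiClosure {r : (Fin 5 → ℂ) →ₗ[ℂ] SymMat}
    {Z : Set P5} (hZ : IsParametrizedBy r Z) (hr : Function.Injective r) (n : ℕ) :
    2 * hilbertFunction (zariskiClosure Z) n = (n + 1) * (3 * n + 2) := by
  rw [hilbertFunction_eq_finrank_map (conicSubst.comp (linearSubst (coordsLinear ∘ₗ r)))
    (fun f => by rw [vanishingIdeal_zariskiClosure, hZ.mem_vanishingIdeal_iff])]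
  rw [AlgHom.comp_toLinearMap, Submodule.map_comp, map_linearSubst_homogeneousSubmodule _
    (coordsLinear_injective.comp hr), map_conicSubst_homogeneousSubmodule,
    Module.finrank_eq_nat_card_basis (basisRestrictSupport ℂ (conicExponents n)),
    card_conicExponents]

lemma IsParametrizedBy.hasDimAndDegree {r : (Fin 5 → ℂ) →ₗ[ℂ] SymMat}
    {Z : Set P5} (hZ : IsParametrizedBy r Z) (hr : Function.Injective r) :
    HasDimAndDegree (zariskiClosure Z) 2 3 := by
  have ha : (3 / 2 : ℚ) ≠ 0 := by norm_num
  refine ⟨Polynomial.C (3 / 2) * Polynomial.X ^ 2 + Polynomial.C (5 / 2) * Polynomial.X +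
    Polynomial.C 1, Filter.Eventually.of_forall fun n => ?_, Polynomial.degree_quadratic ha, ?_⟩
  · have h : (2 : ℚ) * hilbertFunction (zariskiClosure Z) n = (n + 1) * (3 * n + 2) := by
      exact_mod_cast hZ.hilbertFunction_zariskiClosure hr n
    simp only [Polynomial.eval_add, Polynomial.eval_mul, Polynomial.eval_C, Polynomial.eval_pow,
      Polynomial.eval_X]
    linarith
  · rw [Polynomial.leadingCoeff_quadratic ha]
    norm_num [Nat.factorial]

/-! ### Adjugates in the nets of types B and C -/

lemma NetType.g_sq (τ : NetType) : τ.g ^ 2 = τ.g := by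
  cases τ <;> simp [NetType.g]

/-- The adjugate of a member of the standard net, as a function of the conics through the base
point. -/
def NetType.adjLinear (τ : NetType) : (Fin 5 → ℂ) →ₗ[ℂ] SymMat where
  toFun u := ⟨!![-9 * τ.g * u 3 - u 2, u 1 + 3 * τ.g * u 4, -u 0 - 3 * τ.g * u 3;
      u 1 + 3 * τ.g * u 4, -u 0 - 6 * τ.g * u 3, u 4;
      -u 0 - 3 * τ.g * u 3, u 4, -u 3], by
    refine Matrix.IsSymm.ext fun i j => ?_
    fin_cases i <;> fin_cases j <;> rfl⟩
  map_add' u w := by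
    apply symMat_ext <;> simp <;> ring
  map_smul' c u := by
    apply symMat_ext <;> simp <;> ring

lemma NetType.adjLinear_injective (τ : NetType) : Function.Injective τ.adjLinear := by
  rw [injective_iff_map_eq_zero]
  intro u hu
  have h : ∀ i j, (τ.adjLinear u).1 i j = 0 := fun i j => by rw [hu]; rfl
  have h3 := h 2 2
  have h4 := h 1 2
  have h2 := h 0 0
  have h1 := h 0 1
  have h0 := h 0 2
  simp [NetType.adjLinear] at h0 h1 h2 h3 h4
  simp [h3] at h2 h0
  simp [h4] at h1
  ext i
  fin_cases i <;> simp [*]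

/-- The values of the conics through the base point on a symmetric matrix. -/
def NetType.conicLinear (τ : NetType) : SymMat →ₗ[ℂ] (Fin 5 → ℂ) where
  toFun M := ![M.1 0 0 - 4 * τ.g * M.1 0 2 + 4 * τ.g ^ 2 * M.1 2 2,
    M.1 0 1 - 2 * τ.g * M.1 1 2, M.1 1 1, M.1 0 2 - 2 * τ.g * M.1 2 2, M.1 1 2]
  map_add' M N := by
    ext i
    fin_cases i <;> simp <;> ring
  map_smul' c M := by
    ext i
    fin_cases i <;> simp <;> ring

/-- The coordinates in which the base point is `(0 : 0 : 1)`. -/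
def NetType.shift (τ : NetType) (a : Fin 3 → ℂ) : Fin 3 → ℂ :=
  ![a 0 - 2 * τ.g * a 2, a 1, a 2]

lemma NetType.exists_shift_eq (τ : NetType) (b : Fin 3 → ℂ) : ∃ a, τ.shift a = b :=
  ⟨![b 0 + 2 * τ.g * b 2, b 1, b 2], by
    ext i
    fin_cases i <;> simp [NetType.shift]⟩

lemma NetType.conicLinear_veroneseVec (τ : NetType) (a : Fin 3 → ℂ) :
    τ.conicLinear (veroneseVec a) = conics (τ.shift a) := by
  ext i
  fin_cases i <;>
    simp [NetType.conicLinear, NetType.shift, conics, veroneseVec, vecMulVec_apply] <;> ring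

lemma NetType.ker_conicLinear (τ : NetType) :
    LinearMap.ker τ.conicLinear = (veronese τ.basePoint).submodule := by
  change _ = (Projectivization.mk ℂ (veroneseVec _) _).submodule
  rw [Projectivization.submodule_mk]
  ext M
  rw [LinearMap.mem_ker, Submodule.mem_span_singleton]
  constructor
  · intro h
    have h' : ∀ i, τ.conicLinear M i = 0 := fun i => congrFun h i
    have h0 := h' 0
    have h1 := h' 1
    have h2 := h' 2
    have h3 := h' 3
    have h4 := h' 4
    simp [NetType.conicLinear] at h0 h1 h2 h3 h4
    -- The last coordinate of the base point is 1, so the (2,2) entry is the scalar.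
    refine ⟨M.1 2 2, ?_⟩
    apply symMat_ext <;> simp [veroneseVec]
    · linear_combination -h0 - 4 * τ.g * h3
    · exact h2.symm
    · linear_combination -h1 - 2 * τ.g * h4
    · linear_combination -h3
    · exact h4.symm
  · rintro ⟨c, rfl⟩
    rw [map_smul, NetType.conicLinear_veroneseVec]
    ext i
    fin_cases i <;> simp [NetType.shift, conics]

/-- The determinant of a member of the standard net, in shifted coordinates. -/
def NetType.detPoly (τ : NetType) : MvPolynomial (Fin 3) ℂ :=
  X 2 * X 1 ^ 2 + MvPolynomial.C (9 * τ.g) * X 0 * X 2 ^ 2 -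
    (X 0 + MvPolynomial.C (3 * τ.g) * X 2) ^ 2 * X 0

lemma NetType.detPoly_ne_zero (τ : NetType) : τ.detPoly ≠ 0 := by
  intro h
  have := congrArg (eval ![1, 0, 0]) h
  simp [NetType.detPoly] at this

lemma NetType.sum_genMatrix (τ : NetType) (a : Fin 3 → ℂ) :
    ∑ i, a i • τ.genMatrix i = !![-a 2, 0, a 0 + τ.g * a 2; 0, a 0 - 2 * τ.g * a 2, a 1;
      a 0 + τ.g * a 2, a 1, -9 * τ.g * a 2] := by
  cases τ <;> ext i j <;> fin_cases i <;> fin_cases j <;>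
    simp [Fin.sum_univ_three, NetType.genMatrix, NetType.g] <;> ring

lemma NetType.adjugate_sum_genMatrix (τ : NetType) (a : Fin 3 → ℂ) :
    (∑ i, a i • τ.genMatrix i).adjugate = (τ.adjLinear (conics (τ.shift a))).1 := by
  have hg := τ.g_sq
  rw [τ.sum_genMatrix, adjugate_fin_three_of]
  ext i j
  -- Only the middle diagonal entry needs `g² = g`; the others are identities in `g`.
  fin_cases i <;> fin_cases j <;> simp [NetType.adjLinear, conics, NetType.shift] <;>
    first | ring1 | linear_combination -9 * a 2 ^ 2 * hg

lemma NetType.det_sum_genMatrix (τ : NetType) (a : Fin 3 → ℂ) :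
    (∑ i, a i • τ.genMatrix i).det = eval (τ.shift a) τ.detPoly := by
  rw [τ.sum_genMatrix, det_fin_three]
  cases τ <;> simp [NetType.detPoly, NetType.shift, NetType.g] <;> ring

/-- The transpose of the adjugate of an invertible matrix. -/
def adjTranspose (P : GL (Fin 3) ℂ) : GL (Fin 3) ℂ :=
  Matrix.GeneralLinearGroup.mkOfDetNeZero (P.1.adjugate)ᵀ (by
    rw [det_transpose, det_adjugate]
    exact pow_ne_zero _ (Matrix.GeneralLinearGroup.det_ne_zero P))

/-- The adjugate reverses products, so congruence by `P` becomes congruence by `adj(P)ᵀ`. -/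
lemma adjugate_congruence (P : GL (Fin 3) ℂ) (M N : SymMat) (h : M.1.adjugate = N.1) :
    (congruence P M).1.adjugate = (congruence (adjTranspose P) N).1 := by
  change ((P.1)ᵀ * M.1 * P.1).adjugate = ((P.1.adjugate)ᵀ)ᵀ * N.1 * (P.1.adjugate)ᵀ
  rw [adjugate_mul_distrib, adjugate_mul_distrib, h, transpose_transpose, adjugate_transpose,
    Matrix.mul_assoc]

lemma congruence_injective (P : GL (Fin 3) ℂ) : Function.Injective (congruence P) := by
  intro M N h
  have h' : (P.1)ᵀ * M.1 * P.1 = (P.1)ᵀ * N.1 * P.1 := congrArg Subtype.val h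
  have hP : IsUnit P.1 := P.isUnit
  have hPt : IsUnit (P.1)ᵀ := (Matrix.isUnit_transpose P.1).mpr hP
  exact Subtype.ext (hPt.mul_left_cancel (hP.mul_right_cancel h'))

/-- The parametrization of the adjugates in a transform of a standard net. -/
def NetType.netAdj (τ : NetType) (P : GL (Fin 3) ℂ) : (Fin 5 → ℂ) →ₗ[ℂ] SymMat :=
  congruence (adjTranspose P) ∘ₗ τ.adjLinear

lemma NetType.netAdj_injective (τ : NetType) (P : GL (Fin 3) ℂ) :
    Function.Injective (τ.netAdj P) :=
  (congruence_injective _).comp τ.adjLinear_injective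

lemma NetType.sum_smul_congruence_gen (τ : NetType) (P : GL (Fin 3) ℂ) (a : Fin 3 → ℂ) :
    ∑ i, a i • congruence P (τ.gen i) = congruence P (∑ i, a i • τ.gen i) := by
  simp

lemma NetType.coe_sum_gen (τ : NetType) (a : Fin 3 → ℂ) :
    (∑ i, a i • τ.gen i).1 = ∑ i, a i • τ.genMatrix i := by
  simp [NetType.gen]

lemma NetType.adjugate_sum (τ : NetType) (P : GL (Fin 3) ℂ) (a : Fin 3 → ℂ) :
    (∑ i, a i • congruence P (τ.gen i)).1.adjugate =
      (τ.netAdj P (conics (τ.shift a))).1 := by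
  rw [τ.sum_smul_congruence_gen]
  exact adjugate_congruence P _ _ (by rw [τ.coe_sum_gen, τ.adjugate_sum_genMatrix])

lemma NetType.det_sum_ne_zero_iff (τ : NetType) (P : GL (Fin 3) ℂ) (a : Fin 3 → ℂ) :
    (∑ i, a i • congruence P (τ.gen i)).1.det ≠ 0 ↔ eval (τ.shift a) τ.detPoly ≠ 0 := by
  rw [τ.sum_smul_congruence_gen, ← τ.det_sum_genMatrix, ← τ.coe_sum_gen]
  change ((P.1)ᵀ * _ * P.1).det ≠ 0 ↔ _
  rw [det_mul, det_mul, det_transpose]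
  have := Matrix.GeneralLinearGroup.det_ne_zero P
  simp [this]

lemma NetType.mem_map_standardNet (τ : NetType) (P : GL (Fin 3) ℂ) (A : SymMat) :
    A ∈ τ.standardNet.map (congruence P) ↔
      ∃ a : Fin 3 → ℂ, ∑ i, a i • congruence P (τ.gen i) = A := by
  rw [NetType.standardNet, Submodule.map_span, ← Set.range_comp,
    Submodule.mem_span_range_iff_exists_fun]
  rfl

lemma smul_symInv {A : SymMat} (hA : A.1.det ≠ 0) {B : SymMat} (hB : A.1.adjugate = B.1) :
    A.1.det • symInv A = B := by
  apply Subtype.ext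
  change A.1.det • A.1⁻¹ = B.1
  rw [Matrix.inv_def, smul_smul, Ring.mul_inverse_cancel _ (isUnit_iff_ne_zero.mpr hA), one_smul,
    hB]

lemma symInv_ne_zero {A : SymMat} (hA : A.1.det ≠ 0) : symInv A ≠ 0 := by
  intro h
  have h1 : A.1⁻¹ = 0 := congrArg Subtype.val h
  have h2 := Matrix.mul_nonsing_inv A.1 (isUnit_iff_ne_zero.mpr hA)
  rw [h1, mul_zero] at h2
  exact zero_ne_one h2

lemma NetType.isParametrizedBy_inverses (τ : NetType) (P : GL (Fin 3) ℂ) :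
    IsParametrizedBy (τ.netAdj P) {x | ∃ A ∈ τ.standardNet.map (congruence P), A.1.det ≠ 0 ∧
      ∃ h : symInv A ≠ 0, x = Projectivization.mk ℂ (symInv A) h} where
  exists_eq := by
    rintro _ ⟨A, hA, hdet, h, rfl⟩
    obtain ⟨a, rfl⟩ := (τ.mem_map_standardNet P _).mp hA
    have key := smul_symInv hdet (τ.adjugate_sum P a)
    refine ⟨τ.shift a, by rw [← key]; exact smul_ne_zero hdet h, ?_⟩
    rw [Projectivization.mk_eq_mk_iff']
    exact ⟨_, by rw [← key, inv_smul_smul₀ hdet]⟩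
  exists_mem := by
    refine ⟨τ.detPoly, τ.detPoly_ne_zero, fun b hb => ?_⟩
    obtain ⟨a, rfl⟩ := τ.exists_shift_eq b
    have hdet := (τ.det_sum_ne_zero_iff P a).mpr hb
    refine ⟨_, ⟨_, (τ.mem_map_standardNet P _).mpr ⟨a, rfl⟩, hdet, symInv_ne_zero hdet, rfl⟩, ?_⟩
    rw [Projectivization.submodule_mk, ← smul_symInv hdet (τ.adjugate_sum P a)]
    exact Submodule.smul_mem _ _ (Submodule.mem_span_singleton_self _)

/-- The linear map through which the adjugate of a general element of the net factors over the
Veronese embedding. -/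
def NetType.projectionMap (τ : NetType) (P : GL (Fin 3) ℂ) : SymMat →ₗ[ℂ] SymMat :=
  τ.netAdj P ∘ₗ τ.conicLinear

lemma NetType.projectionMap_veroneseVec (τ : NetType) (P : GL (Fin 3) ℂ) (a : Fin 3 → ℂ) :
    τ.projectionMap P (veroneseVec a) = τ.netAdj P (conics (τ.shift a)) := by
  rw [NetType.projectionMap, LinearMap.comp_apply, τ.conicLinear_veroneseVec]

lemma NetType.ker_projectionMap (τ : NetType) (P : GL (Fin 3) ℂ) :
    LinearMap.ker (τ.projectionMap P) = (veronese τ.basePoint).submodule := by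
  rw [NetType.projectionMap, LinearMap.ker_comp_of_ker_eq_bot _
    (LinearMap.ker_eq_bot.mpr (τ.netAdj_injective P)), τ.ker_conicLinear]

lemma veroneseVec_mem_submodule {a : Fin 3 → ℂ} (ha : a ≠ 0) :
    veroneseVec a ∈ (veronese (Projectivization.mk ℂ a ha)).submodule := by
  change _ ∈ (Projectivization.mk ℂ (veroneseVec a) _).submodule
  rw [Projectivization.submodule_mk]
  exact Submodule.mem_span_singleton_self _

lemma conics_ne_zero {b : Fin 3 → ℂ} (hb : b 0 ≠ 0) : conics b ≠ 0 := by
  intro h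
  have h0 : conics b 0 = 0 := by rw [h, Pi.zero_apply]
  exact pow_ne_zero 2 hb h0

lemma NetType.isParametrizedBy_projection (τ : NetType) (P : GL (Fin 3) ℂ) :
    IsParametrizedBy (τ.netAdj P) {y | ∃ x ∈ veroneseSurface, ∃ M ∈ x.submodule,
      ∃ h : τ.projectionMap P M ≠ 0, y = Projectivization.mk ℂ (τ.projectionMap P M) h} where
  exists_eq := by
    rintro _ ⟨_, ⟨x, rfl⟩, M, hM, h, rfl⟩
    induction x using Projectivization.ind with
    | h a ha =>
      change M ∈ (Projectivization.mk ℂ (veroneseVec a) _).submodule at hM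
      rw [Projectivization.submodule_mk, Submodule.mem_span_singleton] at hM
      obtain ⟨c, rfl⟩ := hM
      obtain ⟨b, hb⟩ := smul_conics (τ.netAdj P) c (τ.shift a)
      have key : τ.projectionMap P (c • veroneseVec a) = τ.netAdj P (conics b) := by
        rw [map_smul, τ.projectionMap_veroneseVec, hb]
      generalize τ.projectionMap P (c • veroneseVec a) = N at h key
      subst key
      exact ⟨b, h, rfl⟩
  exists_mem := by
    -- Off the line `b 0 = 0`, which contains the center `(0 : 0 : 1)`, the conic `b 0 ^ 2` is
    -- nonzero.
    refine ⟨X 0, X_ne_zero 0, fun b hb => ?_⟩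
    rw [eval_X] at hb
    obtain ⟨a, rfl⟩ := τ.exists_shift_eq b
    have ha : a ≠ 0 := by
      rintro rfl
      simp [NetType.shift] at hb
    have h : τ.projectionMap P (veroneseVec a) ≠ 0 := by
      rw [τ.projectionMap_veroneseVec]
      exact (map_ne_zero_iff _ (τ.netAdj_injective P)).mpr (conics_ne_zero hb)
    refine ⟨_, ⟨veronese (Projectivization.mk ℂ a ha), ⟨_, rfl⟩, veroneseVec a,
      veroneseVec_mem_submodule ha, h, rfl⟩, ?_⟩
    rw [Projectivization.submodule_mk, τ.projectionMap_veroneseVec]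
    exact Submodule.mem_span_singleton_self _

lemma NetType.isProjectionVia (τ : NetType) (P : GL (Fin 3) ℂ) :
    IsProjectionVia (τ.projectionMap P) veroneseSurface (veronese τ.basePoint)
      (reciprocalSurface (τ.standardNet.map (congruence P))) :=
  ⟨τ.ker_projectionMap P,
    (τ.isParametrizedBy_inverses P).zariskiClosure_eq (τ.isParametrizedBy_projection P)⟩

end

end NetsOfConics

open NetsOfConics in
theorem proposition3p5 (τ : NetType) (L : Submodule ℂ SymMat) (hL : IsOfType τ L) :
    -- the reciprocal surface is a surface of degree 3
    HasDimAndDegree (reciprocalSurface L) 2 3 ∧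
    -- it is a projection of the Veronese surface from a point on the Veronese surface
    (∃ p ∈ veroneseSurface, ∃ π : SymMat →ₗ[ℂ] SymMat,
      IsProjectionVia π veroneseSurface p (reciprocalSurface L)) ∧
    -- more precisely: write `L` as the transform of the standard net by a congruence; then the
    -- linear map through which the adjugate of a general element of the net factors over the
    -- Veronese embedding is such a projection, with center `v(2g : 0 : 1)`
    (∀ P : GL (Fin 3) ℂ, L = τ.standardNet.map (congruence P) →
      ∃ π : SymMat →ₗ[ℂ] SymMat,
        (∀ a : Fin 3 → ℂ, (π (veroneseVec a)).1 =
          (∑ i, a i • congruence P (τ.gen i)).1.adjugate) ∧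
        IsProjectionVia π veroneseSurface (veronese τ.basePoint) (reciprocalSurface L)) := by
  refine ⟨?_, ?_, ?_⟩
  · obtain ⟨P, rfl⟩ := hL
    exact (τ.isParametrizedBy_inverses P).hasDimAndDegree (τ.netAdj_injective P)
  · obtain ⟨P, rfl⟩ := hL
    exact ⟨_, ⟨_, rfl⟩, _, τ.isProjectionVia P⟩
  · rintro P rfl
    exact ⟨τ.projectionMap P,
      fun a => by rw [τ.projectionMap_veroneseVec, τ.adjugate_sum], τ.isProjectionVia P⟩
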